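/- Let $\hat\sigma=(\hat\sigma_x,\hat\sigma_y,\hat\sigma_z)$ be the Pauli matrices, let $\lambda\mapsto\omega_\lambda\in\mathbb{R}^3$ ($\lambda\in\mathbb{R}$) be continuously differentiable with $\|\omega_\lambda\|_2\le 1$ for all $\lambda$, and let $\rho_\lambda=\frac12(I+\omega_\lambda\cdot\hat\sigma)$ be the corresponding family of qubit states. For $\epsilon\ge 0$ let $\overline{\rm LDP}_\epsilon$ be the set of qubit channels (completely positive trace-preserving maps) $\mathcal{E}$ such that $\mathrm{tr}(M\mathcal{E}(\rho))\le e^\epsilon\,\mathrm{tr}(M\mathcal{E}(\sigma))$ for all operators $0\preceq M\preceq I$ and all density operators $\rho,\sigma$, and such that $\mathcal{E}$ has no affine shift, that is, for some $A\in\mathbb{R}^{3\times 3}$, $\mathcal{E}\big(\frac12(I+\omega\cdot\hat\sigma)\big)=\frac12(I+(A\omega)\cdot\hat\sigma)$ for all $\|\omega\|_2\le 1$. Fix $\lambda$ with $\partial_\lambda\omega_\lambda\neq 0$ and $\alpha>0$. For a channel $\mathcal{E}$ let $N_\alpha(\mathcal{E})\in\{1,2,\dots\}\cup\{\infty\}$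 be the least $N\ge 1$ for which there are a positive operator-valued measure on $\mathcal{E}(\rho_\lambda)^{\otimes N}$ and a real-valued estimator $\hat\lambda$, computed from its outcome, that is unbiased in the local sense of the Cramér–Rao inequality (at the fixed value $\lambda$ one has $\mathbb{E}_\lambda\{\hat\lambda\}=\lambda$ and $\partial_{\lambda'}\mathbb{E}_{\lambda'}\{\hat\lambda\}|_{\lambda'=\lambda}=1$, where the mean $\mathbb{E}_{\lambda'}\{\hat\lambda\}$ exists for all $\lambda'$ near $\lambda$) and satisfies $\mathbb{E}_\lambda\{(\lambda-\hat\lambda)^2\}\le\alpha$. Put $$\overline{C}_1=\frac{1}{\|\partial_\lambda\omega_\lambda\|_2}\cdot\frac{1}{\|\partial_\lambda\omega_\lambda\|_2+(\sqrt e(2-\sqrt e))^{-1}},\qquad C_2=\frac{1}{\|\partial_\lambda\omega_\lambda\|_2^2}.$$ Then, for all $\epsilon\in(0,1/2)$, $$\frac{\overline{C}_1}{9\alpha\epsilon^2}\le\frac{\overline{C}_1}{\alpha(e^\epsilon-1)^2}\le\inf_{\mathcal{E}\in\overline{\rm LDP}_\epsilon}N_\alpha(\mathcal{E})\le\left\lceil\frac{C_2(\sqrt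 e+1)^2}{\alpha\epsilon^2}\right\rceil,$$ and the last upper bound holds without rounding, $\inf_{\mathcal{E}\in\overline{\rm LDP}_\epsilon}N_\alpha(\mathcal{E})\le\frac{C_2(\sqrt e+1)^2}{\alpha\epsilon^2}$, whenever $\frac{C_2(\sqrt e+1)^2}{\alpha\epsilon^2}\ge 2$. No condition $\langle\partial_\lambda\omega_\lambda,\omega_\lambda\rangle\neq 0$ is required, so families of pure states are covered. -/

import Mathlib

open Matrix MeasureTheory Filter Topology
open scoped ENNReal ComplexOrder

noncomputable section

/-- Density operators on the finite-dimensional Hilbert space with orthonormal basis `n`: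
positive semidefinite matrices of unit trace. -/
structure DensityMatrix (n : Type) [Fintype n] [DecidableEq n] where
  val : Matrix n n ℂ
  posSemidef : val.PosSemidef
  trace_eq_one : val.trace = 1

/-- Complete positivity: `Φ ⊗ id` on `k × k` block matrices preserves positive semidefiniteness,
for every `k`. -/
def IsCompletelyPositive {n : Type} [Fintype n] [DecidableEq n]
    (Φ : Matrix n n ℂ →ₗ[ℂ] Matrix n n ℂ) : Prop :=
  ∀ (k : ℕ) (X : Matrix (n × Fin k) (n × Fin k) ℂ), X.PosSemidef →
    (Matrix.of fun p q : n × Fin k =>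
      Φ (Matrix.of fun i j : n => X (i, p.2) (j, q.2)) p.1 q.1).PosSemidef

/-- Quantum channels: completely positive trace-preserving linear maps. -/
structure QuantumChannel (n : Type) [Fintype n] [DecidableEq n] where
  toLin : Matrix n n ℂ →ₗ[ℂ] Matrix n n ℂ
  completelyPositive : IsCompletelyPositive toLin
  tracePreserving : ∀ X, (toLin X).trace = X.trace

theorem IsCompletelyPositive.map_posSemidef {n : Type} [Fintype n] [DecidableEq n]
    {Φ : Matrix n n ℂ →ₗ[ℂ] Matrix n n ℂ} (hΦ : IsCompletelyPositive Φ)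
    {X : Matrix n n ℂ} (hX : X.PosSemidef) : (Φ X).PosSemidef := by
  have h := hΦ 1 (X.submatrix Prod.fst Prod.fst) (hX.submatrix _)
  exact h.submatrix (fun i : n => (i, (0 : Fin 1)))

/-- The output state of a channel. -/
def QuantumChannel.apply {n : Type} [Fintype n] [DecidableEq n]
    (E : QuantumChannel n) (ρ : DensityMatrix n) : DensityMatrix n where
  val := E.toLin ρ.val
  posSemidef := E.completelyPositive.map_posSemidef ρ.posSemidef
  trace_eq_one := by rw [E.tracePreserving, ρ.trace_eq_one]

/-- `ε`-local differential privacy: `tr (M E(ρ)) ≤ e^ε tr (M E(σ))` for all `0 ≼ M ≼ I` and all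
density operators `ρ`, `σ`. -/
def QuantumChannel.IsLDP {n : Type} [Fintype n] [DecidableEq n]
    (E : QuantumChannel n) (ε : ℝ) : Prop :=
  ∀ M : Matrix n n ℂ, M.PosSemidef → (1 - M).PosSemidef → ∀ ρ σ : DensityMatrix n,
    (M * (E.apply ρ).val).trace.re ≤ Real.exp ε * (M * (E.apply σ).val).trace.re

/-- The three Pauli matrices. -/
def pauli : Fin 3 → Matrix (Fin 2) (Fin 2) ℂ :=
  ![!![0, 1; 1, 0], !![0, -Complex.I; Complex.I, 0], !![1, 0; 0, -1]]

/-- `(I + ω · σ) / 2`. -/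
def blochMatrix (ω : EuclideanSpace ℝ (Fin 3)) : Matrix (Fin 2) (Fin 2) ℂ :=
  (1 / 2 : ℂ) • (1 + ∑ i, (ω i : ℂ) • pauli i)

theorem blochMatrix_eq (ω : EuclideanSpace ℝ (Fin 3)) :
    blochMatrix ω = !![(1 + (ω 2 : ℂ)) / 2, ((ω 0 : ℂ) - Complex.I * ω 1) / 2;
      ((ω 0 : ℂ) + Complex.I * ω 1) / 2, (1 - (ω 2 : ℂ)) / 2] := by
  ext i j
  fin_cases i <;> fin_cases j <;> simp [blochMatrix, pauli, Fin.sum_univ_three] <;> ring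

theorem blochMatrix_posSemidef (ω : EuclideanSpace ℝ (Fin 3)) (h : ‖ω‖ ≤ 1) :
    (blochMatrix ω).PosSemidef := by
  have hd : 0 ≤ (1 - (ω 0 ^ 2 + ω 1 ^ 2 + ω 2 ^ 2)) / 4 := by
    have h2 := EuclideanSpace.norm_sq_eq ω
    rw [Fin.sum_univ_three] at h2
    simp only [Real.norm_eq_abs, sq_abs] at h2
    nlinarith [norm_nonneg ω]
  have key : blochMatrix ω = (blochMatrix ω)ᴴ * blochMatrix ω +
      (((1 - (ω 0 ^ 2 + ω 1 ^ 2 + ω 2 ^ 2)) / 4 : ℝ) : ℂ) • (1 : Matrix (Fin 2) (Fin 2) ℂ) := by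
    rw [blochMatrix_eq]
    have hI := Complex.I_sq
    ext i j
    have hc : (starRingEnd ℂ) 2 = 2 := map_ofNat _ 2
    fin_cases i <;> fin_cases j <;>
      simp [Matrix.mul_apply, Fin.sum_univ_two, Matrix.conjTranspose_apply, hc] <;>
      first
        | ring1
        | linear_combination (ω 1 : ℂ) ^ 2 / 4 * hI
  rw [key]
  refine (posSemidef_conjTranspose_mul_self _).add (PosSemidef.one.smul ?_)
  exact Complex.zero_le_real.mpr hd

/-- The qubit state with Bloch vector `ω` in the closed unit ball. -/
def blochState (ω : EuclideanSpace ℝ (Fin 3)) (h : ‖ω‖ ≤ 1) : DensityMatrix (Fin 2) where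
  val := blochMatrix ω
  posSemidef := blochMatrix_posSemidef ω h
  trace_eq_one := by
    rw [blochMatrix_eq, Matrix.trace_fin_two]
    simp only [Matrix.of_apply, Matrix.cons_val', Matrix.cons_val_zero, Matrix.cons_val_one,
      Matrix.cons_val_fin_one]
    ring

/-- The qubit channel `E` is given in the Bloch representation by the affine map
`ω ↦ A ω + c` of the unit ball. -/
def QuantumChannel.HasBlochForm (E : QuantumChannel (Fin 2)) (A : Matrix (Fin 3) (Fin 3) ℝ)
    (c : EuclideanSpace ℝ (Fin 3)) : Prop :=
  ∀ ω : EuclideanSpace ℝ (Fin 3), ‖ω‖ ≤ 1 →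
    E.toLin (blochMatrix ω) = blochMatrix (Matrix.toEuclideanLin A ω + c)

/-- The `ε`-locally differentially private qubit channels without affine shift (`c = 0`). -/
def shiftFreeLDP (ε : ℝ) : Set (QuantumChannel (Fin 2)) :=
  {E | E.IsLDP ε ∧ ∃ A : Matrix (Fin 3) (Fin 3) ℝ, E.HasBlochForm A 0}

theorem tensorPower_posSemidef {n : Type} [Fintype n] [DecidableEq n] {A : Matrix n n ℂ}
    (hA : A.PosSemidef) (N : ℕ) :
    (Matrix.of fun x y : Fin N → n => ∏ i, A (x i) (y i)).PosSemidef := by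
  classical
  have h : ∀ s : Finset (Fin N),
      (Matrix.of fun x y : Fin N → n => ∏ i ∈ s, A (x i) (y i)).PosSemidef := by
    intro s
    induction s using Finset.induction_on with
    | empty =>
      have : (Matrix.of fun x y : Fin N → n => ∏ i ∈ (∅ : Finset (Fin N)), A (x i) (y i)) =
          vecMulVec (1 : (Fin N → n) → ℂ) (star 1) := by
        ext x y; simp [vecMulVec_apply]
      rw [this]
      exact posSemidef_vecMulVec_self_star _
    | insert a s ha ih =>
      have : (Matrix.of fun x y : Fin N → n => ∏ i ∈ insert a s, A (x i) (y i)) =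
          Matrix.hadamard (A.submatrix (fun x : Fin N → n => x a) (fun x : Fin N → n => x a))
            (Matrix.of fun x y : Fin N → n => ∏ i ∈ s, A (x i) (y i)) := by
        ext x y; simp [Finset.prod_insert ha]
      rw [this]
      exact (hA.submatrix _).hadamard ih
  exact h Finset.univ

/-- `N` independent copies `ρ^{⊗N}`; the product basis is indexed by `Fin N → n`. -/
def DensityMatrix.tensorPower {n : Type} [Fintype n] [DecidableEq n]
    (ρ : DensityMatrix n) (N : ℕ) : DensityMatrix (Fin N → n) where
  val := Matrix.of fun x y : Fin N → n => ∏ i, ρ.val (x i) (y i)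
  posSemidef := tensorPower_posSemidef ρ.posSemidef N
  trace_eq_one := by
    have h := ρ.trace_eq_one
    simp only [Matrix.trace, Matrix.diag_apply, Matrix.of_apply] at h ⊢
    rw [← Fintype.piFinset_univ, Finset.sum_prod_piFinset Finset.univ
      (fun (_ : Fin N) a => ρ.val a a)]
    simp [h]

/-- Positive operator-valued measures with outcomes in a measurable space `Ω`: countably additive
matrix-valued set functions with positive semidefinite values and total mass `I`. -/
structure POVM (Ω : Type) [MeasurableSpace Ω] (n : Type) [Fintype n] [DecidableEq n] where
  effect : VectorMeasure Ω (Matrix n n ℂ)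
  posSemidef : ∀ S, MeasurableSet S → (effect S).PosSemidef
  effect_univ : effect Set.univ = 1

open scoped MatrixOrder in
theorem re_trace_mul_nonneg {n : Type} [Fintype n] [DecidableEq n] {A B : Matrix n n ℂ}
    (hA : A.PosSemidef) (hB : B.PosSemidef) : 0 ≤ (A * B).trace.re := by
  obtain ⟨C, rfl⟩ := CStarAlgebra.nonneg_iff_eq_star_mul_self.mp hA.nonneg
  rw [star_eq_conjTranspose]
  rw [Matrix.mul_assoc, Matrix.trace_mul_comm]
  exact (Complex.nonneg_iff.mp (hB.mul_mul_conjTranspose_same C).trace_nonneg).1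

/-- Born rule: the distribution of the outcome, `S ↦ tr (ρ M(S))`, when `M` is measured in the
state `ρ`. -/
def POVM.law {Ω : Type} [MeasurableSpace Ω] {n : Type} [Fintype n] [DecidableEq n]
    (M : POVM Ω n) (ρ : DensityMatrix n) : Measure Ω :=
  Measure.ofMeasurable (fun S _ => ENNReal.ofReal (ρ.val * M.effect S).trace.re)
    (by simp)
    (by
      intro f hf hd
      have hs := M.effect.hasSum_of_disjoint_iUnion hf hd
      have hc : Continuous fun X : Matrix n n ℂ => (ρ.val * X).trace.re :=
        Complex.continuous_re.comp (Continuous.matrix_trace (continuous_const.matrix_mul continuous_id))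
      let φ : Matrix n n ℂ →+ ℝ :=
        { toFun := fun X => (ρ.val * X).trace.re
          map_zero' := by simp
          map_add' := by intro X Y; simp [Matrix.mul_add] }
      have hs' : HasSum (fun i => (ρ.val * M.effect (f i)).trace.re)
          (ρ.val * M.effect (⋃ i, f i)).trace.re := hs.map φ hc
      rw [← hs'.tsum_eq]
      exact ENNReal.ofReal_tsum_of_nonneg
        (fun i => re_trace_mul_nonneg ρ.posSemidef (M.posSemidef _ (hf i))) hs'.summable)

/-- The estimator `f` applied to the outcome of `M` is unbiased, in the (local) sense of the
Cramér-Rao inequality, for the family `ρ` at the parameter value `t₀`: its mean equals `t₀` at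
`t₀`, and equals the parameter to first order around `t₀`. -/
def IsLocallyUnbiased {Ω : Type} [MeasurableSpace Ω] {n : Type} [Fintype n] [DecidableEq n]
    (M : POVM Ω n) (f : Ω → ℝ) (ρ : ℝ → DensityMatrix n) (t₀ : ℝ) : Prop :=
  (∀ᶠ t in 𝓝 t₀, Integrable f (M.law (ρ t))) ∧
    ∫ x, f x ∂(M.law (ρ t₀)) = t₀ ∧
    HasDerivAt (fun t => ∫ x, f x ∂(M.law (ρ t))) 1 t₀

/-- Some measurement on `ρ_t^{⊗N}` with an unbiased estimator has mean square error at most `α`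
at the parameter value `t₀`. -/
def AchievesAccuracy {n : Type} [Fintype n] [DecidableEq n] (ρ : ℝ → DensityMatrix n) (t₀ α : ℝ)
    (N : ℕ) : Prop :=
  ∃ (Ω : Type) (_ : MeasurableSpace Ω) (M : POVM Ω (Fin N → n)) (f : Ω → ℝ),
    Measurable f ∧ IsLocallyUnbiased M f (fun t => (ρ t).tensorPower N) t₀ ∧
      ∫⁻ x, ENNReal.ofReal ((t₀ - f x) ^ 2) ∂(M.law ((ρ t₀).tensorPower N)) ≤ ENNReal.ofReal α

/-- The sample complexity of the channel `E`: the least number `N ≥ 1` of copies of `E(ρ_t)` from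
which accuracy `α` is achieved at `t₀` by an unbiased estimator (`⊤` if there is none). -/
def sampleComplexity {n : Type} [Fintype n] [DecidableEq n] (E : QuantumChannel n)
    (ρ : ℝ → DensityMatrix n) (t₀ α : ℝ) : ℕ∞ :=
  ⨅ (N : ℕ) (_ : 1 ≤ N) (_ : AchievesAccuracy (fun t => E.apply (ρ t)) t₀ α N), (N : ℕ∞)

/-- The best-case sample complexity over the shift-free `ε`-LDP qubit channels. -/
def bestSampleComplexity (ε : ℝ) (ρ : ℝ → DensityMatrix (Fin 2)) (t₀ α : ℝ) : ℕ∞ :=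
  ⨅ E ∈ shiftFreeLDP ε, sampleComplexity E ρ t₀ α

/-- The constant of the lower bound, for `D` the norm of the derivative of the Bloch vector. -/
def lowerConst (D : ℝ) : ℝ :=
  (1 / D) * (1 / (D + (Real.sqrt (Real.exp 1) * (2 - Real.sqrt (Real.exp 1)))⁻¹))

/-- The constant of the upper bound, for `D` the norm of the derivative of the Bloch vector. -/
def upperConst (D : ℝ) : ℝ := 1 / D ^ 2

end

/-! Lower bound: if `ρ * K = σ`, positivity of `(x + y(K - 1))ᴴ ρ (x + y(K - 1))` gives a
Hammersley–Chapman–Robbins inequality with χ²-divergence `tr (Kᴴ ρ K) - 1`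
(`POVM.sq_integral_sub_le`). Tensor powers of `K` make `1 + χ²` multiplicative, so dividing by `(t -
t₀) ^ 2` and letting `t → t₀` bounds the information of `N` copies by `N ‖v'‖² / (1 - ‖v‖²)`, `v`
being the output Bloch vector (`one_le_of_achievesAccuracy`). Privacy without shift contracts Bloch
vectors by `η = tanh (ε / 2) < 1` (`norm_toEuclideanLin_le_of_isLDP`). Hence the denominator stays
positive even for pure inputs, and `N ≥ 4 e^ε / (α (e^ε - 1)² D²)` with `D = ‖deriv ω t₀‖`, which
exceeds the stated bound.

Upper bound: the depolarizing channel with the same `η` is private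
(`depolarizing_mem_shiftFreeLDP`). Measuring each copy along the derivative and averaging needs only
`N ≥ 1 / (α η² D²)` (`achievesAccuracy_of_inner`). This is at most two thirds of the claimed bound,
and the slack absorbs the rounding. -/

noncomputable section

/-! ### Hammersley–Chapman–Robbins inequality for measurement outcomes -/

namespace POVM

variable {Ω : Type} [MeasurableSpace Ω] {n : Type} [Fintype n] [DecidableEq n]

theorem law_apply (M : POVM Ω n) (ρ : DensityMatrix n) {S : Set Ω} (hS : MeasurableSet S) :
    M.law ρ S = ENNReal.ofReal (ρ.val * M.effect S).trace.re :=
  Measure.ofMeasurable_apply S hS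

theorem law_real_apply (M : POVM Ω n) (ρ : DensityMatrix n) {S : Set Ω} (hS : MeasurableSet S) :
    (M.law ρ).real S = (ρ.val * M.effect S).trace.re := by
  rw [measureReal_def, law_apply M ρ hS,
    ENNReal.toReal_ofReal (re_trace_mul_nonneg ρ.posSemidef (M.posSemidef _ hS))]

instance (M : POVM Ω n) (ρ : DensityMatrix n) : IsProbabilityMeasure (M.law ρ) := by
  constructor
  rw [law_apply M ρ MeasurableSet.univ, M.effect_univ, mul_one, ρ.trace_eq_one]
  simp

/-- The fibres of a simple function partition the outcome space, so their effects add up to the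
identity. -/
theorem sum_trace_mul_effect_fiber (M : POVM Ω n) (X : Matrix n n ℂ) (g : SimpleFunc Ω ℝ) :
    ∑ r ∈ g.range, (X * M.effect (g ⁻¹' {r})).trace.re = X.trace.re := by
  have h := M.effect.of_biUnion_finset (s := g.range) (f := fun r => g ⁻¹' {r})
    (fun a _ b _ hab => Disjoint.preimage _ (by simpa using hab))
    (fun r _ => g.measurableSet_fiber r)
  have hu : (⋃ r ∈ g.range, g ⁻¹' {r}) = Set.univ := by
    ext x; simp
  rw [hu, M.effect_univ] at h
  rw [← Complex.re_sum, ← trace_sum, ← Finset.mul_sum, ← h, mul_one]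

/-- The quadratic form behind the Hammersley-Chapman-Robbins inequality, setwise. -/
theorem quadratic_nonneg (M : POVM Ω n) (ρ σ : DensityMatrix n) (K : Matrix n n ℂ)
    (hK : ρ.val * K = σ.val) {S : Set Ω} (hS : MeasurableSet S) (x y : ℝ) :
    0 ≤ x ^ 2 * (M.law ρ).real S + 2 * x * y * ((M.law σ).real S - (M.law ρ).real S) +
      y ^ 2 * (((K - 1)ᴴ * ρ.val * (K - 1)) * M.effect S).trace.re := by
  -- Since `ρ (K - 1) = σ - ρ` is Hermitian, both cross terms of this conjugation equal `x y (σ -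
  -- ρ)`.
  have h := re_trace_mul_nonneg
    (ρ.posSemidef.conjTranspose_mul_mul_same ((x : ℂ) • (1 : Matrix n n ℂ) + (y : ℂ) • (K - 1)))
    (M.posSemidef S hS)
  have hK' : ρ.val * (K - 1) = σ.val - ρ.val := by rw [mul_sub, hK, mul_one]
  have hK'' : (K - 1)ᴴ * ρ.val = σ.val - ρ.val := by
    have := congrArg conjTranspose hK'
    rwa [conjTranspose_mul, conjTranspose_sub σ.val, ρ.posSemidef.1.eq, σ.posSemidef.1.eq] at this
  have key : ((x : ℂ) • (1 : Matrix n n ℂ) + (y : ℂ) • (K - 1))ᴴ * ρ.val *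
      ((x : ℂ) • (1 : Matrix n n ℂ) + (y : ℂ) • (K - 1)) =
      (((x ^ 2 : ℝ) : ℂ)) • ρ.val + (((2 * x * y : ℝ) : ℂ)) • (σ.val - ρ.val) +
        ((y ^ 2 : ℝ) : ℂ) • ((K - 1)ᴴ * ρ.val * (K - 1)) := by
    have h1 : ((x : ℂ) • (1 : Matrix n n ℂ) + (y : ℂ) • (K - 1))ᴴ =
        (x : ℂ) • (1 : Matrix n n ℂ) + (y : ℂ) • (K - 1)ᴴ := by
      simp [conjTranspose_add, conjTranspose_smul]
    rw [h1, add_mul, add_mul, mul_add, mul_add]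
    simp only [smul_mul_assoc, mul_smul_comm, one_mul, mul_one, hK', hK'', smul_smul]
    push_cast
    module
  rw [key] at h
  rw [law_real_apply M ρ hS, law_real_apply M σ hS]
  simpa only [add_mul, sub_mul, smul_mul_assoc, trace_add, trace_sub, trace_smul, smul_eq_mul,
    Complex.add_re, Complex.sub_re, Complex.re_ofReal_mul] using h

theorem trace_conj_sub_one (ρ σ : DensityMatrix n) (K : Matrix n n ℂ)
    (hK : ρ.val * K = σ.val) :
    ((K - 1)ᴴ * ρ.val * (K - 1)).trace.re = (Kᴴ * ρ.val * K).trace.re - 1 := by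
  have hK'' : Kᴴ * ρ.val = σ.val := by
    have := congrArg conjTranspose hK
    rwa [conjTranspose_mul, ρ.posSemidef.1.eq, σ.posSemidef.1.eq] at this
  rw [conjTranspose_sub, conjTranspose_one, sub_mul, hK'', one_mul, sub_mul, mul_sub, mul_sub, hK]
  simp [ρ.trace_eq_one, σ.trace_eq_one]

/-- On each fibre, take the setwise form with `x` equal to the value of `g` there, then sum with `y`
fixed. -/
theorem simpleFunc_quadratic_nonneg (M : POVM Ω n) (ρ σ : DensityMatrix n) (K : Matrix n n ℂ)
    (hK : ρ.val * K = σ.val) (g : SimpleFunc Ω ℝ) (y : ℝ) :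
    0 ≤ ∫ x, g x ^ 2 ∂(M.law ρ) + 2 * y * (∫ x, g x ∂(M.law σ) - ∫ x, g x ∂(M.law ρ)) +
      y ^ 2 * ((Kᴴ * ρ.val * K).trace.re - 1) := by
  have hi : ∀ (τ : DensityMatrix n) (F : ℝ → ℝ), F 0 = 0 → ∫ x, F (g x) ∂(M.law τ) =
      ∑ r ∈ g.range, (M.law τ).real (g ⁻¹' {r}) * F r := fun τ F hF => by
    have h := SimpleFunc.integral_eq_integral (g.map F)
      (SimpleFunc.integrable_of_isFiniteMeasure (μ := M.law τ) _)
    rw [SimpleFunc.map_integral g F (SimpleFunc.integrable_of_isFiniteMeasure _) hF] at h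
    exact h.symm
  rw [hi ρ (fun r => r ^ 2) (by simp), hi σ (fun r => r) rfl, hi ρ (fun r => r) rfl,
    ← trace_conj_sub_one ρ σ K hK, ← M.sum_trace_mul_effect_fiber _ g]
  rw [← Finset.sum_sub_distrib, Finset.mul_sum, Finset.mul_sum, ← Finset.sum_add_distrib,
    ← Finset.sum_add_distrib]
  refine Finset.sum_nonneg fun r _ => ?_
  have := M.quadratic_nonneg ρ σ K hK (g.measurableSet_fiber r) r y
  linarith

/-- Hammersley-Chapman-Robbins inequality for the outcome of a quantum measurement, with the
`χ²`-divergence of `σ` from `ρ` written as `tr (K† ρ K) - 1` for `ρ K = σ`. -/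
theorem sq_integral_sub_le (M : POVM Ω n) (ρ σ : DensityMatrix n) (K : Matrix n n ℂ)
    (hK : ρ.val * K = σ.val) (g : Ω → ℝ) (hg : Measurable g) (hρ : Integrable g (M.law ρ))
    (hσ : Integrable g (M.law σ)) (h2 : Integrable (fun x => g x ^ 2) (M.law ρ)) :
    (∫ x, g x ∂(M.law σ) - ∫ x, g x ∂(M.law ρ)) ^ 2 ≤
      (∫ x, g x ^ 2 ∂(M.law ρ)) * ((Kᴴ * ρ.val * K).trace.re - 1) := by
  -- Simple approximations dominated by `2 ‖g‖` carry the quadratic form to `g`; its discriminant in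
  -- `y` is then nonpositive.
  let G : ℕ → SimpleFunc Ω ℝ := fun k => SimpleFunc.approxOn g hg Set.univ 0 (Set.mem_univ _) k
  have hb : ∀ k x, ‖G k x‖ ≤ 2 * ‖g x‖ := fun k x => by
    have := SimpleFunc.norm_approxOn_zero_le hg (Set.mem_univ (0 : ℝ)) x k
    change ‖G k x‖ ≤ _ at this
    linarith
  have hl : ∀ x, Tendsto (fun k => G k x) atTop (𝓝 (g x)) := fun x =>
    SimpleFunc.tendsto_approxOn hg (Set.mem_univ _) (by simp)
  have h1 : ∀ τ : DensityMatrix n, Integrable g (M.law τ) →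
      Tendsto (fun k => ∫ x, G k x ∂(M.law τ)) atTop (𝓝 (∫ x, g x ∂(M.law τ))) := fun τ hτ =>
    tendsto_integral_of_dominated_convergence (fun x => 2 * ‖g x‖)
      (fun k => (G k).aestronglyMeasurable) (hτ.norm.const_mul 2)
      (fun k => Eventually.of_forall (hb k)) (Eventually.of_forall hl)
  have h3 : Tendsto (fun k => ∫ x, G k x ^ 2 ∂(M.law ρ)) atTop
      (𝓝 (∫ x, g x ^ 2 ∂(M.law ρ))) := by
    refine tendsto_integral_of_dominated_convergence (fun x => 4 * g x ^ 2)
      (fun k => ((G k).measurable.pow_const 2).aestronglyMeasurable) (h2.const_mul 4)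
      (fun k => Eventually.of_forall fun x => ?_) (Eventually.of_forall fun x => (hl x).pow 2)
    have h := hb k x
    rw [norm_pow, ← sq_abs (g x), ← Real.norm_eq_abs]
    nlinarith [norm_nonneg (G k x), norm_nonneg (g x)]
  have hq : ∀ y : ℝ, 0 ≤ ((Kᴴ * ρ.val * K).trace.re - 1) * (y * y) +
      (2 * (∫ x, g x ∂(M.law σ) - ∫ x, g x ∂(M.law ρ))) * y + ∫ x, g x ^ 2 ∂(M.law ρ) := by
    intro y
    have := ge_of_tendsto' ((h3.add (((h1 σ hσ).sub (h1 ρ hρ)).const_mul (2 * y))).add_const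
      (y ^ 2 * ((Kᴴ * ρ.val * K).trace.re - 1)))
      (fun k => M.simpleFunc_quadratic_nonneg ρ σ K hK (G k) y)
    linarith
  have := discrim_le_zero hq
  rw [discrim] at this
  linarith

end POVM

/-! ### Tensor products of matrices -/

/-- The tensor product `A₁ ⊗ ⋯ ⊗ A_N` of a family of matrices. -/
def matrixPiTensor {n : Type} {N : ℕ} (A : Fin N → Matrix n n ℂ) :
    Matrix (Fin N → n) (Fin N → n) ℂ :=
  Matrix.of fun x y => ∏ i, A i (x i) (y i)

section PiTensor

variable {n : Type} {N : ℕ}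

theorem matrixPiTensor_conjTranspose (A : Fin N → Matrix n n ℂ) :
    (matrixPiTensor A)ᴴ = matrixPiTensor fun i => (A i)ᴴ := by
  ext x y
  simp [matrixPiTensor, conjTranspose_apply]

theorem matrixPiTensor_one [DecidableEq n] :
    matrixPiTensor (fun _ : Fin N => (1 : Matrix n n ℂ)) = 1 := by
  ext x y
  simp [matrixPiTensor, Matrix.one_apply, Finset.prod_ite_zero, funext_iff]

theorem sum_matrixPiTensor {κ : Type} [Fintype κ] (P : κ → Matrix n n ℂ) :
    ∑ b : Fin N → κ, matrixPiTensor (fun i => P (b i)) =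
      matrixPiTensor fun _ : Fin N => ∑ k, P k := by
  ext x y
  simp only [matrixPiTensor, Matrix.sum_apply, Matrix.of_apply]
  rw [← Fintype.piFinset_univ,
    Finset.sum_prod_piFinset Finset.univ (fun i k => P k (x i) (y i))]

variable [Fintype n]

theorem matrixPiTensor_mul (A B : Fin N → Matrix n n ℂ) :
    matrixPiTensor A * matrixPiTensor B = matrixPiTensor fun i => A i * B i := by
  ext x y
  simp only [matrixPiTensor, Matrix.mul_apply, Matrix.of_apply, ← Finset.prod_mul_distrib]
  rw [← Fintype.piFinset_univ,
    Finset.sum_prod_piFinset Finset.univ (fun i a => A i (x i) a * B i a (y i))]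

theorem trace_matrixPiTensor (A : Fin N → Matrix n n ℂ) :
    (matrixPiTensor A).trace = ∏ i, (A i).trace := by
  simp only [Matrix.trace, Matrix.diag_apply, Matrix.of_apply, matrixPiTensor]
  rw [← Fintype.piFinset_univ, Finset.sum_prod_piFinset Finset.univ (fun i a => A i a a)]

-- Factor each `A i` as `Cᴴ C`; the tensor product factors accordingly.
open scoped MatrixOrder in
theorem matrixPiTensor_posSemidef [DecidableEq n] {A : Fin N → Matrix n n ℂ}
    (hA : ∀ i, (A i).PosSemidef) : (matrixPiTensor A).PosSemidef := by
  choose C hC using fun i => CStarAlgebra.nonneg_iff_eq_star_mul_self.mp (hA i).nonneg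
  have h : matrixPiTensor A = (matrixPiTensor C)ᴴ * matrixPiTensor C := by
    rw [matrixPiTensor_conjTranspose, matrixPiTensor_mul]
    exact congrArg matrixPiTensor (funext hC)
  rw [h]
  exact posSemidef_conjTranspose_mul_self _

theorem DensityMatrix.tensorPower_val [DecidableEq n] (ρ : DensityMatrix n) (N : ℕ) :
    (ρ.tensorPower N).val = matrixPiTensor fun _ => ρ.val := rfl

end PiTensor

/-! ### Algebra of Bloch matrices -/

theorem blochMatrix_trace (v : EuclideanSpace ℝ (Fin 3)) : (blochMatrix v).trace = 1 := by
  rw [blochMatrix_eq, Matrix.trace_fin_two]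
  simp only [Matrix.of_apply, Matrix.cons_val', Matrix.cons_val_zero, Matrix.cons_val_one,
    Matrix.cons_val_fin_one]
  ring

theorem blochMatrix_isHermitian (v : EuclideanSpace ℝ (Fin 3)) : (blochMatrix v)ᴴ = blochMatrix v := by
  rw [blochMatrix_eq]
  ext i j
  fin_cases i <;> fin_cases j <;> simp [conjTranspose_apply]
  ring

theorem one_sub_blochMatrix (v : EuclideanSpace ℝ (Fin 3)) :
    1 - blochMatrix v = blochMatrix (-v) := by
  rw [blochMatrix_eq, blochMatrix_eq]
  ext i j
  fin_cases i <;> fin_cases j <;> simp <;> ring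

theorem trace_blochMatrix_mul (v w : EuclideanSpace ℝ (Fin 3)) :
    (blochMatrix v * blochMatrix w).trace.re = (1 + inner ℝ v w) / 2 := by
  rw [blochMatrix_eq, blochMatrix_eq, Matrix.trace_fin_two]
  simp [Matrix.mul_apply, Fin.sum_univ_two, PiLp.inner_apply, Fin.sum_univ_three]
  ring

theorem norm_sq_fin_three (v : EuclideanSpace ℝ (Fin 3)) :
    ‖v‖ ^ 2 = v 0 ^ 2 + v 1 ^ 2 + v 2 ^ 2 := by
  rw [EuclideanSpace.norm_sq_eq, Fin.sum_univ_three]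
  simp

/-- The second factor is the adjugate of the first, so the scalar is the determinant. This supplies
the inverse when `‖v‖ < 1`. -/
theorem blochMatrix_mul_neg (v : EuclideanSpace ℝ (Fin 3)) :
    blochMatrix v * blochMatrix (-v) =
      (((1 - ‖v‖ ^ 2) / 4 : ℝ) : ℂ) • (1 : Matrix (Fin 2) (Fin 2) ℂ) := by
  have hI := Complex.I_sq
  rw [norm_sq_fin_three, blochMatrix_eq, blochMatrix_eq]
  ext i j
  fin_cases i <;> fin_cases j <;> simp [Matrix.mul_apply, Fin.sum_univ_two] <;>
  first
    | ring1
    | linear_combination (v 1 : ℂ) ^ 2 / 4 * hI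

theorem re_trace_blochMatrix_triple (v w : EuclideanSpace ℝ (Fin 3)) :
    (blochMatrix w * blochMatrix (-v) * blochMatrix w).trace.re =
      (1 - ‖v‖ ^ 2 + ‖w - v‖ ^ 2) / 4 := by
  rw [norm_sq_fin_three, norm_sq_fin_three, blochMatrix_eq, blochMatrix_eq, Matrix.trace_fin_two]
  simp [Matrix.mul_apply, Fin.sum_univ_two]
  ring

/-- The `χ²`-divergence of qubit states is `‖w - v‖² / (1 - ‖v‖²)`. -/
theorem exists_blochMatrix_mul_eq (v w : EuclideanSpace ℝ (Fin 3)) (hv : ‖v‖ < 1) :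
    ∃ K : Matrix (Fin 2) (Fin 2) ℂ, blochMatrix v * K = blochMatrix w ∧
      (Kᴴ * blochMatrix v * K).trace = ((1 + ‖w - v‖ ^ 2 / (1 - ‖v‖ ^ 2) : ℝ) : ℂ) := by
  have hpos : 0 < 1 - ‖v‖ ^ 2 := by nlinarith [norm_nonneg v]
  have hne : (((1 - ‖v‖ ^ 2) / 4 : ℝ) : ℂ) ≠ 0 := Complex.ofReal_ne_zero.mpr (by positivity)
  -- This is `ρ⁻¹ σ`, the inverse being adjugate over determinant.
  set K : Matrix (Fin 2) (Fin 2) ℂ :=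
    (((1 - ‖v‖ ^ 2) / 4 : ℝ) : ℂ)⁻¹ • (blochMatrix (-v) * blochMatrix w) with hKdef
  have hK : blochMatrix v * K = blochMatrix w := by
    rw [hKdef, mul_smul_comm, ← Matrix.mul_assoc, blochMatrix_mul_neg, smul_mul_assoc, one_mul,
      smul_smul, inv_mul_cancel₀ hne, one_smul]
  have hK' : Kᴴ * blochMatrix v = blochMatrix w := by
    have := congrArg conjTranspose hK
    rwa [conjTranspose_mul, blochMatrix_isHermitian, blochMatrix_isHermitian] at this
  refine ⟨K, hK, ?_⟩
  -- The full complex trace is needed: on tensor powers it is the trace, not its real part, that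
  -- multiplies.
  have him : (Kᴴ * blochMatrix v * K).trace.im = 0 := by
    have := ((blochMatrix_posSemidef v hv.le).conjTranspose_mul_mul_same K).trace_nonneg
    exact (Complex.nonneg_iff.mp this).2.symm
  apply Complex.ext
  · rw [hK', hKdef, mul_smul_comm, trace_smul, smul_eq_mul, ← Complex.ofReal_inv,
      Complex.re_ofReal_mul, ← Matrix.mul_assoc, re_trace_blochMatrix_triple, Complex.ofReal_re]
    field_simp
  · rw [him, Complex.ofReal_im]

/-! ### Cramér–Rao inequality for qubits -/

/-- Cramér-Rao inequality for qubit families, with the right logarithmic derivative information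
`‖v'‖² / (1 - ‖v‖²)` of the Bloch vector. -/
theorem one_le_of_achievesAccuracy (ρ : ℝ → DensityMatrix (Fin 2))
    (v : ℝ → EuclideanSpace ℝ (Fin 3)) (hρ : ∀ t, (ρ t).val = blochMatrix (v t))
    {t₀ α : ℝ} (hα : 0 ≤ α) {v' : EuclideanSpace ℝ (Fin 3)} (hv : HasDerivAt v v' t₀)
    (hlt : ‖v t₀‖ < 1) {N : ℕ} (h : AchievesAccuracy ρ t₀ α N) :
    1 ≤ α * (N * (‖v'‖ ^ 2 / (1 - ‖v t₀‖ ^ 2))) := by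
  obtain ⟨Ω, mΩ, M, f, hf, ⟨hint, hmean, hder⟩, hmse⟩ := h
  set μ : ℝ → Measure Ω := fun t => M.law ((ρ t).tensorPower N) with hμ
  set q : ℝ → ℝ := fun t => ‖v t - v t₀‖ ^ 2 / (1 - ‖v t₀‖ ^ 2) with hq
  have hg : Measurable fun x => f x - t₀ := hf.sub_const t₀
  have hmse' : ∫⁻ x, ENNReal.ofReal ((f x - t₀) ^ 2) ∂(μ t₀) ≤ ENNReal.ofReal α := by
    simpa only [← neg_sub t₀, neg_sq] using hmse
  have hsq : Integrable (fun x => (f x - t₀) ^ 2) (μ t₀) := by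
    refine ⟨(hg.pow_const 2).aestronglyMeasurable, ?_⟩
    rw [hasFiniteIntegral_iff_ofReal (Eventually.of_forall fun x => sq_nonneg _)]
    exact hmse'.trans_lt ENNReal.ofReal_lt_top
  have hvar : ∫ x, (f x - t₀) ^ 2 ∂(μ t₀) ≤ α := by
    rw [integral_eq_lintegral_of_nonneg_ae (Eventually.of_forall fun x => sq_nonneg _)
      (hg.pow_const 2).aestronglyMeasurable]
    exact ENNReal.toReal_le_of_le_ofReal hα hmse'
  have hint₀ : Integrable f (μ t₀) := hint.self_of_nhds
  -- With `K^{⊗N}` as the quotient of the tensor powers, the divergence is `(1 + q t) ^ N - 1`.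
  have hbound : ∀ t, Integrable f (μ t) →
      (∫ x, f x ∂(μ t) - ∫ x, f x ∂(μ t₀)) ^ 2 ≤ α * ((1 + q t) ^ N - 1) := by
    intro t ht
    obtain ⟨K, hK, hKtr⟩ := exists_blochMatrix_mul_eq (v t₀) (v t) hlt
    rw [← hρ, ← hρ] at hK
    rw [← hρ] at hKtr
    have hKN : ((ρ t₀).tensorPower N).val * (matrixPiTensor fun _ => K) =
        ((ρ t).tensorPower N).val := by
      rw [DensityMatrix.tensorPower_val, DensityMatrix.tensorPower_val, matrixPiTensor_mul, hK]
    have htr : ((matrixPiTensor fun _ => K)ᴴ * ((ρ t₀).tensorPower N).val *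
        matrixPiTensor fun _ => K).trace.re = (1 + q t) ^ N := by
      rw [DensityMatrix.tensorPower_val, matrixPiTensor_conjTranspose, matrixPiTensor_mul,
        matrixPiTensor_mul, trace_matrixPiTensor, hKtr, Finset.prod_const,
        Finset.card_univ, Fintype.card_fin, ← Complex.ofReal_pow,
        Complex.ofReal_re]
    have hsub : ∀ s, Integrable f (μ s) →
        ∫ x, (f x - t₀) ∂(μ s) = ∫ x, f x ∂(μ s) - t₀ := fun s hs => by
      rw [integral_sub hs (integrable_const _)]
      simp [hμ]
    have h1 := M.sq_integral_sub_le ((ρ t₀).tensorPower N) ((ρ t).tensorPower N)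
      (matrixPiTensor fun _ => K) hKN (fun x => f x - t₀) hg (hint₀.sub (integrable_const _))
      (ht.sub (integrable_const _)) hsq
    rw [htr] at h1
    have h2 := hsub t ht
    have h3 := hsub t₀ hint₀
    simp only [hμ] at h2 h3
    rw [h2, h3, sub_sub_sub_cancel_right] at h1
    refine h1.trans (mul_le_mul_of_nonneg_right hvar (sub_nonneg.mpr (one_le_pow₀ ?_)))
    have : 0 ≤ q t := div_nonneg (sq_nonneg _) (by nlinarith [norm_nonneg (v t₀)])
    linarith
  have hl : Tendsto (fun t => (slope (fun t => ∫ x, f x ∂(μ t)) t₀ t) ^ 2) (𝓝[≠] t₀)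
      (𝓝 (1 ^ 2)) := (hasDerivAt_iff_tendsto_slope.mp hder).pow 2
  have hq0 : Tendsto q (𝓝[≠] t₀) (𝓝 0) := by
    have h1 : ContinuousAt q t₀ :=
      ((hv.continuousAt.sub continuousAt_const).norm.pow 2).div_const _
    have h2 : q t₀ = 0 := by simp [hq]
    rw [← h2]
    exact h1.tendsto.mono_left nhdsWithin_le_nhds
  -- The geometric sum is `((1 + q t) ^ N - 1) / q t`, tending to `N`; the other factor is `q t / (t
  -- - t₀) ^ 2`.
  have hr : Tendsto (fun t => α * ((∑ i ∈ Finset.range N, (1 + q t) ^ i) *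
      (‖slope v t₀ t‖ ^ 2 / (1 - ‖v t₀‖ ^ 2)))) (𝓝[≠] t₀)
      (𝓝 (α * ((∑ i ∈ Finset.range N, (1 + 0 : ℝ) ^ i) * (‖v'‖ ^ 2 / (1 - ‖v t₀‖ ^ 2))))) := by
    refine Tendsto.const_mul _ (Tendsto.mul ?_ ?_)
    · exact tendsto_finsetSum _ fun i _ => (hq0.const_add 1).pow i
    · exact ((hasDerivAt_iff_tendsto_slope.mp hv).norm.pow 2).div_const _
  have hfin := le_of_tendsto_of_tendsto hl hr ?_
  · simpa using hfin
  filter_upwards [hint.filter_mono nhdsWithin_le_nhds, self_mem_nhdsWithin] with t ht hne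
  have hsub : t - t₀ ≠ 0 := sub_ne_zero.mpr hne
  have hne' : 0 < (t - t₀) ^ 2 := by positivity
  have hb := hbound t ht
  rw [← mul_geom_sum] at hb
  rw [slope_def_field, slope_def_module, norm_smul, div_pow, div_le_iff₀ hne', mul_pow, norm_inv,
    inv_pow, Real.norm_eq_abs, sq_abs]
  refine hb.trans_eq ?_
  rw [add_sub_cancel_left]
  generalize ∑ i ∈ Finset.range N, (1 + q t) ^ i = s
  simp only [hq]
  field_simp

/-! ### Privacy as contraction, and the lower bound -/

/-- The factor `tanh (ε / 2)` by which an `ε`-LDP channel contracts the Bloch ball. -/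
def ldpContraction (ε : ℝ) : ℝ := (Real.exp ε - 1) / (Real.exp ε + 1)

theorem ldpContraction_pos {ε : ℝ} (hε : 0 < ε) : 0 < ldpContraction ε := by
  have := Real.one_lt_exp_iff.mpr hε
  exact div_pos (by linarith) (by linarith)

theorem ldpContraction_lt_one (ε : ℝ) : ldpContraction ε < 1 := by
  have := Real.exp_pos ε
  rw [ldpContraction, div_lt_one (by linarith)]
  linarith

/-- Antipodal inputs `x` and `-x` have antipodal outputs `y` and `-y`. Testing along `y` gives `1 +
‖y‖ ≤ e^ε (1 - ‖y‖)`, and homogeneity extends the bound beyond the unit ball. -/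
theorem norm_toEuclideanLin_le_of_isLDP {E : QuantumChannel (Fin 2)} {ε : ℝ} (hE : E.IsLDP ε)
    {A : Matrix (Fin 3) (Fin 3) ℝ} (hA : E.HasBlochForm A 0) (u : EuclideanSpace ℝ (Fin 3)) :
    ‖Matrix.toEuclideanLin A u‖ ≤ ldpContraction ε * ‖u‖ := by
  have hexp := Real.exp_pos ε
  have hball : ∀ x : EuclideanSpace ℝ (Fin 3), ‖x‖ ≤ 1 →
      ‖Matrix.toEuclideanLin A x‖ ≤ ldpContraction ε := by
    intro x hx
    set y := Matrix.toEuclideanLin A x with hy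
    rcases eq_or_ne y 0 with h0 | h0
    -- The effect `1` forces `e^ε ≥ 1`, so the contraction factor is nonnegative.
    · have h := hE 1 PosSemidef.one (by simpa using PosSemidef.zero) (blochState x hx)
        (blochState x hx)
      simp only [one_mul, (E.apply _).trace_eq_one, Complex.one_re, mul_one] at h
      rw [h0, norm_zero]
      exact div_nonneg (by linarith) (by linarith)
    · set m : EuclideanSpace ℝ (Fin 3) := ‖y‖⁻¹ • y with hm
      have hm1 : ‖m‖ ≤ 1 := (norm_smul_inv_norm (𝕜 := ℝ) h0).le
      have hmy : inner ℝ m y = ‖y‖ := by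
        rw [hm, real_inner_smul_left, real_inner_self_eq_norm_sq]
        field_simp [norm_ne_zero_iff.mpr h0]
      have hx' : ‖-x‖ ≤ 1 := by rwa [norm_neg]
      have h := hE (blochMatrix m) (blochMatrix_posSemidef m hm1)
        (by rw [one_sub_blochMatrix]; exact blochMatrix_posSemidef _ (by rwa [norm_neg]))
        (blochState x hx) (blochState (-x) hx')
      have h1 : (E.apply (blochState x hx)).val = blochMatrix y :=
        (hA x hx).trans (by rw [add_zero])
      have h2 : (E.apply (blochState (-x) hx')).val = blochMatrix (-y) :=
        (hA (-x) hx').trans (by rw [add_zero, map_neg])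
      rw [h1, h2, trace_blochMatrix_mul, trace_blochMatrix_mul, inner_neg_right, hmy] at h
      rw [ldpContraction, le_div_iff₀ (by linarith)]
      linarith
  rcases eq_or_ne u 0 with h0 | h0
  · simp [h0]
  · have h := hball (‖u‖⁻¹ • u) (norm_smul_inv_norm (𝕜 := ℝ) h0).le
    rw [map_smul, norm_smul, norm_inv, norm_norm, inv_mul_le_iff₀ (norm_pos_iff.mpr h0)] at h
    linarith

/-- Every shift-free `ε`-LDP channel needs at least `4 e^ε / (α (e^ε - 1)² D²)` samples. -/
theorem le_of_achievesAccuracy_of_mem_shiftFreeLDP {E : QuantumChannel (Fin 2)} {ε : ℝ}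
    (hε : 0 < ε) (hE : E ∈ shiftFreeLDP ε) {ω : ℝ → EuclideanSpace ℝ (Fin 3)}
    (hball : ∀ t, ‖ω t‖ ≤ 1) {t₀ α : ℝ} (hα : 0 < α) (hω : DifferentiableAt ℝ ω t₀) {N : ℕ}
    (h : AchievesAccuracy (fun t => E.apply (blochState (ω t) (hball t))) t₀ α N) :
    4 * Real.exp ε ≤ N * (α * (Real.exp ε - 1) ^ 2 * ‖deriv ω t₀‖ ^ 2) := by
  obtain ⟨hldp, A, hA⟩ := hE
  have hexp := Real.one_lt_exp_iff.mpr hε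
  set L : EuclideanSpace ℝ (Fin 3) →L[ℝ] EuclideanSpace ℝ (Fin 3) :=
    LinearMap.toContinuousLinearMap (Matrix.toEuclideanLin A)
  have hn : ∀ u, ‖L u‖ ≤ ldpContraction ε * ‖u‖ := norm_toEuclideanLin_le_of_isLDP hldp hA
  have hpos := ldpContraction_pos hε
  have hlt1 := ldpContraction_lt_one ε
  have h0 : ‖L (ω t₀)‖ ≤ ldpContraction ε :=
    (hn _).trans (mul_le_of_le_one_right hpos.le (hball t₀))
  have hcr := one_le_of_achievesAccuracy _ (fun t => L (ω t))
    (fun t => (hA (ω t) (hball t)).trans (by rw [add_zero]; rfl)) hα.le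
    (L.hasFDerivAt.comp_hasDerivAt t₀ hω.hasDerivAt) (h0.trans_lt hlt1) h
  have hden : 0 < 1 - ldpContraction ε ^ 2 := by nlinarith
  -- The information increases in both norms, so the two contraction bounds may be inserted
  -- together.
  have hle : ‖L (deriv ω t₀)‖ ^ 2 / (1 - ‖L (ω t₀)‖ ^ 2) ≤
      (ldpContraction ε * ‖deriv ω t₀‖) ^ 2 / (1 - ldpContraction ε ^ 2) := by
    gcongr
    exact hn _
  have heq : (ldpContraction ε * ‖deriv ω t₀‖) ^ 2 / (1 - ldpContraction ε ^ 2) =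
      (Real.exp ε - 1) ^ 2 * ‖deriv ω t₀‖ ^ 2 / (4 * Real.exp ε) := by
    have h1 : Real.exp ε + 1 ≠ 0 := by positivity
    have h2 : 1 - ldpContraction ε ^ 2 = 4 * Real.exp ε / (Real.exp ε + 1) ^ 2 := by
      rw [ldpContraction]
      field_simp
      ring
    rw [h2, ldpContraction]
    field_simp
  rw [heq] at hle
  have hfin := hcr.trans (mul_le_mul_of_nonneg_left
    (mul_le_mul_of_nonneg_left hle N.cast_nonneg) hα.le)
  rw [mul_div_assoc', mul_div_assoc', le_div_iff₀ (by positivity)] at hfin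
  linarith

/-! ### Finite measurements and independent repetition -/

namespace POVM

variable {Ω : Type} [MeasurableSpace Ω] [Fintype Ω] {n : Type} [Fintype n] [DecidableEq n]

/-- The measurement with finitely many outcomes `x`, of effects `e x`. -/
def ofFintype (e : Ω → Matrix n n ℂ) (he : ∀ x, (e x).PosSemidef) (hsum : ∑ x, e x = 1) :
    POVM Ω n where
  effect := ∑ x, VectorMeasure.dirac x (e x)
  posSemidef S hS := by
    rw [FunLike.coe_sum, Finset.sum_apply]
    refine posSemidef_sum _ fun x _ => ?_
    by_cases hx : x ∈ S
    · rw [VectorMeasure.dirac_apply_of_mem hS hx]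
      exact he x
    · rw [VectorMeasure.dirac_apply_of_notMem hx]
      exact PosSemidef.zero
  effect_univ := by
    rw [FunLike.coe_sum, Finset.sum_apply, ← hsum]
    exact Finset.sum_congr rfl fun x _ =>
      VectorMeasure.dirac_apply_of_mem MeasurableSet.univ (Set.mem_univ x)

theorem law_ofFintype_singleton [MeasurableSingletonClass Ω] {e : Ω → Matrix n n ℂ}
    (he : ∀ x, (e x).PosSemidef) (hsum : ∑ x, e x = 1) (ρ : DensityMatrix n) (x : Ω) :
    (ofFintype e he hsum).law ρ {x} = ENNReal.ofReal (ρ.val * e x).trace.re := by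
  rw [law_apply _ _ (measurableSet_singleton x)]
  congr 4
  change (∑ y, VectorMeasure.dirac y (e y)) {x} = e x
  rw [FunLike.coe_sum, Finset.sum_apply, Finset.sum_eq_single x]
  · exact VectorMeasure.dirac_apply_of_mem (measurableSet_singleton x) rfl
  · intro y _ hy
    exact VectorMeasure.dirac_apply_of_notMem (by simpa using hy)
  · simp

/-- Measuring each of `N` copies independently. -/
def piOfFintype (N : ℕ) (e : Ω → Matrix n n ℂ) (he : ∀ x, (e x).PosSemidef)
    (hsum : ∑ x, e x = 1) : POVM (Fin N → Ω) (Fin N → n) :=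
  ofFintype (fun b => matrixPiTensor fun i => e (b i))
    (fun _ => matrixPiTensor_posSemidef fun _ => he _)
    (by rw [sum_matrixPiTensor, hsum, matrixPiTensor_one])

/-- With finitely many outcomes it suffices to compare singletons, where the Born probability
factors over the copies. -/
theorem law_piOfFintype [MeasurableSingletonClass Ω] (N : ℕ) {e : Ω → Matrix n n ℂ}
    (he : ∀ x, (e x).PosSemidef) (hsum : ∑ x, e x = 1) (ρ : DensityMatrix n) :
    (piOfFintype N e he hsum).law (ρ.tensorPower N) =
      Measure.pi fun _ : Fin N => (ofFintype e he hsum).law ρ := by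
  refine Measure.ext_of_singleton fun b => ?_
  rw [piOfFintype, law_ofFintype_singleton, Measure.pi_singleton, DensityMatrix.tensorPower_val,
    matrixPiTensor_mul, trace_matrixPiTensor]
  simp only [law_ofFintype_singleton]
  have hnn : ∀ x, 0 ≤ (ρ.val * e x).trace.re := fun x => re_trace_mul_nonneg ρ.posSemidef (he x)
  -- Each trace is real, so the real part of the product is the product of the real parts.
  have him : ∀ x, (ρ.val * e x).trace = (((ρ.val * e x).trace.re : ℝ) : ℂ) := fun x => by
    refine (Complex.conj_eq_iff_re.mp ?_).symm
    rw [starRingEnd_apply, ← trace_conjTranspose, conjTranspose_mul, (he x).1.eq,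
      ρ.posSemidef.1.eq, trace_mul_comm]
  rw [← ENNReal.ofReal_prod_of_nonneg fun i _ => hnn (b i)]
  congr 1
  rw [Finset.prod_congr rfl fun i _ => him (b i), ← Complex.ofReal_prod, Complex.ofReal_re]

end POVM

/-! ### Estimation by spin measurements -/

/-- The effects of the projective qubit measurement along `m`. -/
def blochEffect (m : EuclideanSpace ℝ (Fin 3)) (b : Bool) : Matrix (Fin 2) (Fin 2) ℂ :=
  blochMatrix (if b then m else -m)

theorem blochEffect_posSemidef {m : EuclideanSpace ℝ (Fin 3)} (hm : ‖m‖ ≤ 1) (b : Bool) :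
    (blochEffect m b).PosSemidef :=
  blochMatrix_posSemidef _ (by cases b <;> simpa using hm)

theorem sum_blochEffect (m : EuclideanSpace ℝ (Fin 3)) : ∑ b, blochEffect m b = 1 := by
  simp [blochEffect, ← one_sub_blochMatrix]

/-- The measurement of the spin along `m`. -/
def spinPOVM {m : EuclideanSpace ℝ (Fin 3)} (hm : ‖m‖ ≤ 1) : POVM Bool (Fin 2) :=
  POVM.ofFintype (blochEffect m) (blochEffect_posSemidef hm) (sum_blochEffect m)

theorem integral_spinPOVM_law {m v : EuclideanSpace ℝ (Fin 3)} (hm : ‖m‖ ≤ 1)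
    (ρ : DensityMatrix (Fin 2)) (hρ : ρ.val = blochMatrix v) (F : Bool → ℝ) :
    ∫ b, F b ∂((spinPOVM hm).law ρ) =
      (1 + inner ℝ m v) / 2 * F true + (1 - inner ℝ m v) / 2 * F false := by
  have h : ∀ b, ((spinPOVM hm).law ρ).real {b} = (1 + (if b then 1 else -1) * inner ℝ m v) / 2 := by
    intro b
    rw [measureReal_def, spinPOVM, POVM.law_ofFintype_singleton,
      ENNReal.toReal_ofReal (re_trace_mul_nonneg ρ.posSemidef (blochEffect_posSemidef hm b)),
      hρ, blochEffect, trace_blochMatrix_mul, real_inner_comm]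
    cases b <;> simp
  rw [integral_fintype .of_finite]
  rw [Fintype.sum_bool, h, h]
  simp only [smul_eq_mul, if_true, Bool.false_eq_true, if_false]
  ring

/-- Measuring the spin along `m` on each copy and averaging achieves the accuracy
`1 / (N ⟨m, v'⟩²)`. -/
theorem achievesAccuracy_of_inner (ρ : ℝ → DensityMatrix (Fin 2))
    (v : ℝ → EuclideanSpace ℝ (Fin 3)) (hρ : ∀ t, (ρ t).val = blochMatrix (v t))
    {t₀ α : ℝ} {v' m : EuclideanSpace ℝ (Fin 3)} (hv : HasDerivAt v v' t₀) (hm : ‖m‖ ≤ 1)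
    (hne : inner ℝ m v' ≠ 0) {N : ℕ} (hN : 1 ≤ N) (h : 1 / (N * (inner ℝ m v') ^ 2) ≤ α) :
    AchievesAccuracy ρ t₀ α N := by
  set a : ℝ := inner ℝ m v' with ha
  have hN0 : (N : ℝ) ≠ 0 := by positivity
  -- The `±1` outcome is centred at `t₀` and scaled so that the sum of `N` means has derivative `1`
  -- there.
  set Y : Bool → ℝ := fun b => ((if b then 1 else -1) - inner ℝ m (v t₀)) / (N * a) with hY
  set μ : ℝ → Measure Bool := fun t => (spinPOVM hm).law (ρ t) with hμ
  have hYint : ∀ t, ∫ b, Y b ∂(μ t) = (inner ℝ m (v t) - inner ℝ m (v t₀)) / (N * a) := by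
    intro t
    rw [hμ, integral_spinPOVM_law hm (ρ t) (hρ t)]
    simp [hY]
    ring
  have hlaw : ∀ t, (POVM.piOfFintype N (blochEffect m) (blochEffect_posSemidef hm)
      (sum_blochEffect m)).law ((ρ t).tensorPower N) = Measure.pi fun _ : Fin N => μ t :=
    fun t => POVM.law_piOfFintype N _ _ (ρ t)
  have hprob : ∀ t, IsProbabilityMeasure (μ t) := fun t => by
    rw [hμ]; infer_instance
  have hmean : ∀ t, ∫ b, (t₀ + ∑ i, Y (b i)) ∂(Measure.pi fun _ : Fin N => μ t) =
      t₀ + (inner ℝ m (v t) - inner ℝ m (v t₀)) / a := by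
    intro t
    rw [integral_add .of_finite .of_finite, integral_finsetSum _ fun i _ => .of_finite]
    simp only [integral_comp_eval (μ := fun _ : Fin N => μ t)
      (measurable_of_finite Y).aestronglyMeasurable, hYint]
    simp
    field_simp
  refine ⟨Fin N → Bool, inferInstance, POVM.piOfFintype N (blochEffect m)
    (blochEffect_posSemidef hm) (sum_blochEffect m), fun b => t₀ + ∑ i, Y (b i),
    measurable_of_finite _, ⟨?_, ?_, ?_⟩, ?_⟩
  · refine Eventually.of_forall fun t => ?_
    exact .of_finite
  · simp only [hlaw, hmean]
    simp
  · simp only [hlaw, hmean]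
    have hd : HasDerivAt (fun t => inner ℝ m (v t)) a t₀ := by
      simpa using (hasDerivAt_const t₀ m).inner ℝ hv
    have := ((hd.sub_const (inner ℝ m (v t₀))).div_const a).const_add t₀
    rwa [div_self hne] at this
  · simp only [hlaw]
    rw [← ofReal_integral_eq_lintegral_ofReal .of_finite (Eventually.of_forall fun _ => sq_nonneg _)]
    refine ENNReal.ofReal_le_ofReal (le_trans ?_ h)
    have hvar := ProbabilityTheory.variance_sum_pi (μ := fun _ : Fin N => μ t₀)
      (X := fun _ => Y) (fun _ => MemLp.of_discrete)
    rw [ProbabilityTheory.variance_of_integral_eq_zero (measurable_of_finite _).aemeasurable,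
      ProbabilityTheory.variance_of_integral_eq_zero (measurable_of_finite _).aemeasurable] at hvar
    · have h1 : ∫ b, Y b ^ 2 ∂(μ t₀) = (1 - inner ℝ m (v t₀) ^ 2) / (N * a) ^ 2 := by
        rw [hμ, integral_spinPOVM_law hm (ρ t₀) (hρ t₀) (fun b => Y b ^ 2)]
        simp only [hY]
        field_simp
        simp
        ring
      have h2 : ∀ b : Fin N → Bool, (t₀ - (t₀ + ∑ i, Y (b i))) ^ 2 =
          (∑ i, fun b : Fin N → Bool => Y (b i)) b ^ 2 := fun b => by
        rw [Finset.sum_apply]; ring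
      simp only [h2]
      rw [hvar]
      simp only [Finset.sum_const, Finset.card_univ, Fintype.card_fin, nsmul_eq_mul, h1]
      -- The variance is `(1 - ⟨m, v t₀⟩²) / (N a²)`; the subtracted square is discarded.
      rw [mul_div_assoc', div_le_div_iff₀ (by positivity) (by positivity)]
      have : 0 ≤ (N : ℝ) * (N * a ^ 2) * inner ℝ m (v t₀) ^ 2 := by positivity
      nlinarith
    · rw [hYint]; simp
    · simp only [Finset.sum_apply]
      rw [integral_finsetSum _ fun i _ => .of_finite]
      simp only [integral_comp_eval (μ := fun _ : Fin N => μ t₀)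
        (measurable_of_finite Y).aestronglyMeasurable, hYint]
      simp

/-! ### The depolarizing channel -/

/-- In dimension two `1 - ρ` is the adjugate of `ρ`. -/
theorem DensityMatrix.one_sub_posSemidef (ρ : DensityMatrix (Fin 2)) :
    (1 - ρ.val).PosSemidef := by
  have h := ρ.posSemidef.transpose.conjTranspose_mul_mul_same !![0, 1; -1, 0]
  have ht := ρ.trace_eq_one
  rw [Matrix.trace_fin_two] at ht
  suffices heq : 1 - ρ.val = !![0, 1; -1, 0]ᴴ * ρ.valᵀ * !![0, 1; -1, 0] by rwa [heq]
  ext i j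
  fin_cases i <;> fin_cases j <;>
    simp [Matrix.mul_apply, Fin.sum_univ_two, conjTranspose_apply] <;> linear_combination -ht

/-- The linear map `X ↦ η X + (1 - η) tr X / 2`. -/
def depolarizingLin (η : ℝ) : Matrix (Fin 2) (Fin 2) ℂ →ₗ[ℂ] Matrix (Fin 2) (Fin 2) ℂ :=
  (η : ℂ) • LinearMap.id +
    (((1 - η) / 2 : ℝ) : ℂ) • (Matrix.traceLinearMap (Fin 2) ℂ ℂ).smulRight 1

theorem depolarizingLin_apply (η : ℝ) (X : Matrix (Fin 2) (Fin 2) ℂ) :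
    depolarizingLin η X = (η : ℂ) • X + (((1 - η) / 2 : ℝ) : ℂ) • (X.trace • 1) :=
  rfl

/-- The depolarizing channel `X ↦ η X + (1 - η) tr X / 2`. -/
def depolarizing (η : ℝ) (h0 : 0 ≤ η) (h1 : η ≤ 1) : QuantumChannel (Fin 2) where
  toLin := depolarizingLin η
  completelyPositive k X hX := by
    -- The ampliated channel mixes `X` with `1 ⊗ tr₁ X`, where `tr₁` is the partial trace over the
    -- qubit.
    have key : (Matrix.of fun p q : Fin 2 × Fin k =>
        depolarizingLin η (Matrix.of fun i j : Fin 2 => X (i, p.2) (j, q.2)) p.1 q.1) =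
        (η : ℂ) • X + (((1 - η) / 2 : ℝ) : ℂ) • Matrix.kronecker (1 : Matrix (Fin 2) (Fin 2) ℂ)
          (∑ i : Fin 2, X.submatrix (fun a => (i, a)) (fun a => (i, a))) := by
      ext p q
      simp [depolarizingLin_apply, Matrix.trace, Matrix.kroneckerMap_apply, mul_comm]
    rw [key]
    refine (hX.smul (Complex.zero_le_real.mpr h0)).add
      (PosSemidef.smul ?_ (Complex.zero_le_real.mpr (by linarith)))
    exact PosSemidef.one.kronecker (posSemidef_sum _ fun i _ => hX.submatrix _)
  tracePreserving X := by
    rw [depolarizingLin_apply]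
    simp [trace_add, trace_smul]
    ring

theorem depolarizing_apply (η : ℝ) (h0 : 0 ≤ η) (h1 : η ≤ 1) (X : Matrix (Fin 2) (Fin 2) ℂ) :
    (depolarizing η h0 h1).toLin X = (η : ℂ) • X + (((1 - η) / 2 : ℝ) : ℂ) • (X.trace • 1) :=
  rfl

theorem depolarizing_blochMatrix (η : ℝ) (h0 : 0 ≤ η) (h1 : η ≤ 1)
    (v : EuclideanSpace ℝ (Fin 3)) :
    (depolarizing η h0 h1).toLin (blochMatrix v) = blochMatrix (η • v) := by
  rw [depolarizing_apply, blochMatrix_trace, blochMatrix_eq, blochMatrix_eq]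
  ext i j
  fin_cases i <;> fin_cases j <;> simp <;> ring

/-- The extreme values are `tr (M ρ) ≤ tr M` and `tr (M σ) ≥ 0`; at these, privacy is the identity
`e^ε (1 - η) = 1 + η`. -/
theorem depolarizing_mem_shiftFreeLDP {ε : ℝ} (h0 : 0 ≤ ldpContraction ε) :
    depolarizing (ldpContraction ε) h0 (ldpContraction_lt_one ε).le ∈ shiftFreeLDP ε := by
  have hexp := Real.exp_pos ε
  refine ⟨fun M hM hM' ρ σ => ?_, ldpContraction ε • 1, fun v _ => ?_⟩
  · have htr : ∀ τ : DensityMatrix (Fin 2),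
        (M * ((depolarizing (ldpContraction ε) h0 (ldpContraction_lt_one ε).le).apply τ).val).trace.re
          = ldpContraction ε * (M * τ.val).trace.re + (1 - ldpContraction ε) / 2 * M.trace.re := by
      intro τ
      change (M * (depolarizing (ldpContraction ε) h0 (ldpContraction_lt_one ε).le).toLin
        τ.val).trace.re = _
      rw [depolarizing_apply, τ.trace_eq_one, one_smul, mul_add, mul_smul_comm, mul_smul_comm,
        mul_one, trace_add, trace_smul, trace_smul, smul_eq_mul, smul_eq_mul, Complex.add_re,
        Complex.re_ofReal_mul, Complex.re_ofReal_mul]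
    have hnn := re_trace_mul_nonneg hM σ.posSemidef
    have hle : (M * ρ.val).trace.re ≤ M.trace.re := by
      have h := re_trace_mul_nonneg hM ρ.one_sub_posSemidef
      rw [mul_sub, mul_one, trace_sub, Complex.sub_re] at h
      linarith
    rw [htr, htr]
    have hη : Real.exp ε * (1 - ldpContraction ε) = 1 + ldpContraction ε := by
      rw [ldpContraction]
      field_simp
      ring
    have h3 : 0 ≤ Real.exp ε * (ldpContraction ε * (M * σ.val).trace.re) := by positivity
    have h4 := mul_le_mul_of_nonneg_left hle h0
    linear_combination h3 + h4 - hη * M.trace.re / 2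
  · rw [depolarizing_blochMatrix, add_zero]
    congr 1
    simp

theorem achievesAccuracy_depolarizing {η : ℝ} (h0 : 0 < η) (h1 : η ≤ 1)
    {ω : ℝ → EuclideanSpace ℝ (Fin 3)} (hball : ∀ t, ‖ω t‖ ≤ 1) {t₀ α : ℝ}
    (hω : DifferentiableAt ℝ ω t₀) (hderiv : deriv ω t₀ ≠ 0) (hα : 0 < α) {N : ℕ} (hN : 1 ≤ N)
    (h : 1 / (α * η ^ 2 * ‖deriv ω t₀‖ ^ 2) ≤ N) :
    AchievesAccuracy (fun t => (depolarizing η h0.le h1).apply (blochState (ω t) (hball t)))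
      t₀ α N := by
  have hD : 0 < ‖deriv ω t₀‖ := norm_pos_iff.mpr hderiv
  have hin : inner ℝ (‖deriv ω t₀‖⁻¹ • deriv ω t₀) (η • deriv ω t₀) = η * ‖deriv ω t₀‖ := by
    rw [real_inner_smul_left, real_inner_smul_right, real_inner_self_eq_norm_sq]
    field_simp
  refine achievesAccuracy_of_inner _ (fun t => η • ω t)
    (fun t => depolarizing_blochMatrix η h0.le h1 (ω t)) (hω.hasDerivAt.const_smul η)
    (m := ‖deriv ω t₀‖⁻¹ • deriv ω t₀) (norm_smul_inv_norm (𝕜 := ℝ) hderiv).le ?_ hN ?_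
  · rw [hin]
    positivity
  · rw [hin]
    rw [div_le_iff₀ (by positivity)] at h ⊢
    linarith

end

/-! ### Numerical constants and rounding -/

theorem inv_sqrt_exp_one_nonneg :
    0 ≤ (Real.sqrt (Real.exp 1) * (2 - Real.sqrt (Real.exp 1)))⁻¹ := by
  have h : Real.sqrt (Real.exp 1) ≤ 2 := by
    rw [Real.sqrt_le_left (by norm_num)]
    linarith [Real.exp_one_lt_d9]
  exact inv_nonneg.mpr (mul_nonneg (Real.sqrt_nonneg _) (by linarith))

theorem lowerConst_nonneg {D : ℝ} (hD : 0 ≤ D) : 0 ≤ lowerConst D := by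
  have := inv_sqrt_exp_one_nonneg
  unfold lowerConst
  positivity

theorem lowerConst_le {D : ℝ} (hD : 0 < D) : lowerConst D ≤ 1 / D ^ 2 := by
  have := inv_sqrt_exp_one_nonneg
  rw [lowerConst, sq, ← one_div_mul_one_div]
  gcongr
  linarith

/-- On this range `ε coth (ε / 2) ≤ 2.15`, while `√e ≥ 1.64` gives `2.15² ≤ (2 / 3) (√e + 1)²`. -/
theorem one_div_sq_ldpContraction_le {ε : ℝ} (hε : ε ∈ Set.Ioo (0 : ℝ) (1 / 2)) :
    1 / ldpContraction ε ^ 2 ≤ 2 / 3 * ((Real.sqrt (Real.exp 1) + 1) ^ 2 / ε ^ 2) := by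
  obtain ⟨h0, h1⟩ := hε
  have hq := Real.quadratic_le_exp_of_nonneg h0.le
  have hs : (1.64 : ℝ) ≤ Real.sqrt (Real.exp 1) := by
    rw [Real.le_sqrt (by norm_num) (Real.exp_pos 1).le]
    linarith [Real.exp_one_gt_d9]
  have hu : ε * (Real.exp ε + 1) ≤ 2.15 * (Real.exp ε - 1) := by
    nlinarith [mul_nonneg (sub_nonneg.mpr hq) (by linarith : (0 : ℝ) ≤ 2.15 - ε), mul_pos h0 h0,
      mul_pos h0 (sub_pos.mpr h1), mul_pos (mul_pos h0 h0) (sub_pos.mpr h1)]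
  have hu1 : 0 < Real.exp ε - 1 := by nlinarith
  have h2 : 1 / ldpContraction ε ≤ 2.15 / ε := by
    rw [ldpContraction, one_div_div, div_le_div_iff₀ hu1 h0]
    linarith
  calc 1 / ldpContraction ε ^ 2 = (1 / ldpContraction ε) ^ 2 := by rw [_root_.one_div_pow]
    _ ≤ (2.15 / ε) ^ 2 := by
      have := ldpContraction_pos h0
      gcongr
    _ = 2.15 ^ 2 / ε ^ 2 := div_pow _ _ _
    _ ≤ (2 / 3 * (Real.sqrt (Real.exp 1) + 1) ^ 2) / ε ^ 2 := by
      gcongr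
      nlinarith
    _ = _ := mul_div_assoc _ _ _

/-- For `x ≤ 2` the ceiling is at most `2 ≤ y`; for `x > 2` it is below `x + 1 < 3 x / 2 ≤ y`. -/
theorem ceil_le_of_le_two_thirds {x y : ℝ} (hxy : x ≤ 2 / 3 * y) (hy : 2 ≤ y) :
    (⌈x⌉₊ : ℝ) ≤ y := by
  rcases le_or_gt x 2 with h | h
  · have : ⌈x⌉₊ ≤ 2 := Nat.ceil_le.mpr (by exact_mod_cast h)
    exact le_trans (by exact_mod_cast this) hy
  · have := Nat.ceil_lt_add_one (by linarith : 0 ≤ x)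
    linarith

/-! ### The sample complexity bounds -/

theorem theorem2
    (ω : ℝ → EuclideanSpace ℝ (Fin 3)) (hω : ContDiff ℝ 1 ω) (hball : ∀ t, ‖ω t‖ ≤ 1)
    (t₀ : ℝ) (hderiv : deriv ω t₀ ≠ 0)
    (ε : ℝ) (hε : ε ∈ Set.Ioo (0 : ℝ) (1 / 2)) (α : ℝ) (hα : 0 < α) :
    lowerConst ‖deriv ω t₀‖ / (9 * α * ε ^ 2) ≤
        lowerConst ‖deriv ω t₀‖ / (α * (Real.exp ε - 1) ^ 2) ∧
      ENNReal.ofReal (lowerConst ‖deriv ω t₀‖ / (α * (Real.exp ε - 1) ^ 2)) ≤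
        ((bestSampleComplexity ε (fun t => blochState (ω t) (hball t)) t₀ α : ℕ∞) : ℝ≥0∞) ∧
      bestSampleComplexity ε (fun t => blochState (ω t) (hball t)) t₀ α ≤
        ((⌈upperConst ‖deriv ω t₀‖ * (Real.sqrt (Real.exp 1) + 1) ^ 2 / (α * ε ^ 2)⌉₊ : ℕ) : ℕ∞) ∧
      (2 ≤ upperConst ‖deriv ω t₀‖ * (Real.sqrt (Real.exp 1) + 1) ^ 2 / (α * ε ^ 2) →
        ((bestSampleComplexity ε (fun t => blochState (ω t) (hball t)) t₀ α : ℕ∞) : ℝ≥0∞) ≤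
          ENNReal.ofReal
            (upperConst ‖deriv ω t₀‖ * (Real.sqrt (Real.exp 1) + 1) ^ 2 / (α * ε ^ 2))) := by

  obtain ⟨hε0, hε1⟩ := id hε
  have hD : 0 < ‖deriv ω t₀‖ := norm_pos_iff.mpr hderiv
  have hdiff : DifferentiableAt ℝ ω t₀ := (hω.differentiable one_ne_zero) t₀
  have hexp := Real.one_lt_exp_iff.mpr hε0
  have hu : 0 < Real.exp ε - 1 := by linarith
  have hη := ldpContraction_pos hε0
  set D := ‖deriv ω t₀‖ with hDdef
  set U := upperConst D * (Real.sqrt (Real.exp 1) + 1) ^ 2 / (α * ε ^ 2) with hU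
  have hpos : 0 < 1 / (α * ldpContraction ε ^ 2 * D ^ 2) := by positivity
  have hxU : 1 / (α * ldpContraction ε ^ 2 * D ^ 2) ≤ 2 / 3 * U := by
    have h := mul_le_mul_of_nonneg_left (one_div_sq_ldpContraction_le hε)
      (by positivity : 0 ≤ 1 / (α * D ^ 2))
    have h1 : 1 / (α * D ^ 2) * (1 / ldpContraction ε ^ 2) =
        1 / (α * ldpContraction ε ^ 2 * D ^ 2) := by
      rw [one_div_mul_one_div]
      ring_nf
    have h2 : 1 / (α * D ^ 2) * (2 / 3 * ((Real.sqrt (Real.exp 1) + 1) ^ 2 / ε ^ 2)) =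
        2 / 3 * U := by
      rw [hU, upperConst]
      field_simp
    rwa [h1, h2] at h
  have hbest : bestSampleComplexity ε (fun t => blochState (ω t) (hball t)) t₀ α ≤
      ((⌈1 / (α * ldpContraction ε ^ 2 * D ^ 2)⌉₊ : ℕ) : ℕ∞) := by
    have hN : 1 ≤ ⌈1 / (α * ldpContraction ε ^ 2 * D ^ 2)⌉₊ := Nat.one_le_ceil_iff.mpr hpos
    exact (iInf₂_le _ (depolarizing_mem_shiftFreeLDP hη.le)).trans
      ((iInf₂_le _ hN).trans (iInf_le _ (achievesAccuracy_depolarizing hη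
        (ldpContraction_lt_one ε).le hball hdiff hderiv hα hN (Nat.le_ceil _))))
  refine ⟨?_, ?_, ?_, ?_⟩
  -- The estimate `e^ε - 1 ≤ 2 ε` would give the constant `4`, so `9` is ample.
  · have h := Real.abs_exp_sub_one_le (x := ε) (by rw [abs_of_pos hε0]; linarith)
    rw [abs_of_pos hε0, abs_of_pos hu] at h
    have h2 : α * (Real.exp ε - 1) ^ 2 ≤ 9 * α * ε ^ 2 := by
      have : (Real.exp ε - 1) ^ 2 ≤ (2 * ε) ^ 2 := by gcongr
      nlinarith [mul_le_mul_of_nonneg_left this hα.le, mul_pos hα (mul_pos hε0 hε0)]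
    exact div_le_div_of_nonneg_left (lowerConst_nonneg hD.le) (by positivity) h2
  · have hlow : ((⌈lowerConst D / (α * (Real.exp ε - 1) ^ 2)⌉₊ : ℕ) : ℕ∞) ≤
        bestSampleComplexity ε (fun t => blochState (ω t) (hball t)) t₀ α := by
      refine le_iInf₂ fun E hE => le_iInf fun N => le_iInf fun _ => le_iInf fun hacc => ?_
      have h := le_of_achievesAccuracy_of_mem_shiftFreeLDP hε0 hE hball hα hdiff hacc
      rw [Nat.cast_le, Nat.ceil_le, div_le_iff₀ (by positivity)]
      -- Only `1 / D ^ 2` is needed; the factor `4 e^ε ≥ 1` of the sharper bound is given away.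
      refine (lowerConst_le hD).trans ?_
      rw [div_le_iff₀ (by positivity)]
      linarith
    refine le_trans ?_ (ENat.toENNReal_le.mpr hlow)
    rw [ENat.toENNReal_coe, ENNReal.ofReal_le_natCast]
    exact Nat.le_ceil _
  · refine hbest.trans (Nat.cast_le.mpr (Nat.ceil_mono ?_))
    linarith
  · intro h2
    refine (ENat.toENNReal_le.mpr hbest).trans ?_
    rw [ENat.toENNReal_coe, ENNReal.natCast_le_ofReal]
    · exact ceil_le_of_le_two_thirds hxU h2
    · exact (Nat.ceil_pos.mpr hpos).ne'
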